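/- Let $\Gamma$ be a finitely generated non-amenable group, let $S$ be a finite symmetric generating set of $\Gamma$, and let $d$ be the associated word distance, $B(e,n)$ being the ball of radius $n$ around the identity $e$. There exists a probability measure $\mu$ on $\Gamma$ with the following properties: - $\mu$ is admissible, i.e. its support generates $\Gamma$ as a semigroup; - $\mu$ is symmetric, i.e. $\mu(g^{-1})=\mu(g)$ for all $g\in\Gamma$; - $\mu$ has exponential tails, i.e. there exists $M>1$ such that $\mu(\Gamma\setminus B(e,n))\le M^{-n}$ for all large enough $n$; - its Green function $G(x,y)=\sum_{n\ge 0}\mu^{n}(x^{-1}y)$, where $\mu^{n}$ denotes the $n$-th convolution power of $\mu$, is finite for all $x,y\in\Gamma$; - $G$ does not satisfy Ancona inequalities: there is no constant $C$ such that $G(x,z)\le C\,G(x,y)\,G(y,z)$ for all $x,y,z\in\Gamma$ lying in this order on a geodesic for $d$. -/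

import Mathlib

open Filter
open scoped ENNReal NNReal

/-- A discrete group is amenable if it carries a left-invariant finitely additive probability
measure defined on all of its subsets. -/
def IsAmenableGroup (Γ : Type*) [Group Γ] : Prop :=
  ∃ m : Set Γ → ℝ≥0∞, m Set.univ = 1 ∧
    (∀ s t : Set Γ, Disjoint s t → m (s ∪ t) = m s + m t) ∧
    ∀ (g : Γ) (s : Set Γ), m ((fun x => g * x) '' s) = m s

/-- The word distance associated to a set of generators: the graph distance in the Cayley graph,
where `x` is joined to `x * s` for `s` in `S`. -/
noncomputable def wordDist {Γ : Type*} [Group Γ] (S : Set Γ) (x y : Γ) : ℕ :=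
  (SimpleGraph.mulCayley S).dist x y

/-- The points `x`, `y`, `z` lie in this order on a geodesic segment for the word distance:
there is a sequence `γ 0, …, γ L` with `d (γ i) (γ j) = j - i` for `i ≤ j ≤ L` which passes
successively through `x`, `y` and `z`. -/
def OrderedOnGeodesic {Γ : Type*} [Group Γ] (S : Set Γ) (x y z : Γ) : Prop :=
  ∃ (L : ℕ) (γ : ℕ → Γ),
    (∀ i j : ℕ, i ≤ j → j ≤ L → wordDist S (γ i) (γ j) = j - i) ∧
    ∃ i j k : ℕ, i ≤ j ∧ j ≤ k ∧ k ≤ L ∧ γ i = x ∧ γ j = y ∧ γ k = z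

open Classical in
/-- The convolution powers of a measure on a discrete group, given by its point masses:
`μ^0` is the Dirac mass at the identity and `μ^(n+1) (g) = ∑ h, μ^n (h) μ (h⁻¹ g)`. -/
noncomputable def convPow {Γ : Type*} [Group Γ] (μ : Γ → ℝ≥0∞) : ℕ → Γ → ℝ≥0∞
  | 0 => fun g => if g = 1 then 1 else 0
  | n + 1 => fun g => ∑' h : Γ, convPow μ n h * μ (h⁻¹ * g)

/-- The Green function `G (x, y) = ∑ n, μ^n (x⁻¹ y)`, with values in `[0, ∞]`. -/
noncomputable def green {Γ : Type*} [Group Γ] (μ : Γ → ℝ≥0∞) (x y : Γ) : ℝ≥0∞ :=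
  ∑' n : ℕ, convPow μ n (x⁻¹ * y)

/-- A probability measure is admissible if its support generates the group as a semigroup. -/
def IsAdmissible {Γ : Type*} [Group Γ] (μ : PMF Γ) : Prop :=
  Subsemigroup.closure μ.support = ⊤

/-- A probability measure is symmetric if it is invariant under inversion. -/
def IsSymmetricPMF {Γ : Type*} [Group Γ] (μ : PMF Γ) : Prop :=
  ∀ g : Γ, μ g⁻¹ = μ g

/-- Exponential tails: for some `M > 1`, the complement of the ball of radius `n` around the
identity has mass at most `M ^ (-n)` for all large `n`. -/
def HasExponentialTails {Γ : Type*} [Group Γ] (S : Set Γ) (μ : PMF Γ) : Prop :=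
  ∃ M : ℝ, 1 < M ∧
    ∀ᶠ n : ℕ in atTop, μ.toOuterMeasure {g : Γ | n < wordDist S 1 g} ≤ ENNReal.ofReal ((M ^ n)⁻¹)

/-! Write `|g|` for word length and `w n = (1 + η) ^ n * (1 + η * n)`. The weight `w |g|` is
submultiplicative, yet `w n ^ 2` exceeds `w (2 * n)` by a factor of order `n`. The measure is the
normalized sum of the uniform measure on `S ∪ {1}` and a small `τ` with atoms at sparse points `x j`
of length `2 * 4 ^ j` and at their inverses, of mass about `2 ^ (-j) / w (2 * 4 ^ j)`.

By Kesten's theorem (`exists_l2_contraction`) the uniform part contracts `ℓ²`. For small `η` and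
small weighted mass of `τ`, convolution by `μ` times the weight still has norm at most some `r < 1`.
Submultiplicativity then gives `G (x, y) ≤ K / w (d (x, y))` with `K = 1 / (1 - r)`
(`green_mul_le`), and finiteness of the weighted mass gives exponential tails.

If `y j` is the midpoint of a geodesic from `1` to `x j`, Ancona would yield `μ (x j) ≤ G (1, x j) ≤
C * K ^ 2 / w (4 ^ j) ^ 2`. The atom is larger than this by a factor of order `2 ^ (-j) * 4 ^ j = 2
^ j`, a contradiction. -/

/-! ### Non-amenability and Kesten's theorem -/

/-- In a non-amenable group, probability vectors are displaced in `ℓ¹`, by a uniform amount, by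
some generator. -/
theorem exists_displacement_of_not_isAmenableGroup {Γ : Type*} [Group Γ]
    (hΓ : ¬ IsAmenableGroup Γ) {S : Set Γ} (hSsymm : ∀ s ∈ S, s⁻¹ ∈ S)
    (hSgen : Subgroup.closure S = ⊤) :
    ∃ δ : ℝ≥0, 0 < δ ∧ ∀ p : Γ → ℝ≥0∞, ∑' g, p g = 1 →
      ∃ s ∈ S, (δ : ℝ≥0∞) ≤ ∑' g, (p (g * s) - p g) := by
  by_contra! H
  apply hΓ
  have H' : ∀ n : ℕ, ∃ p : Γ → ℝ≥0∞, ∑' g, p g = 1 ∧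
      ∀ s ∈ S, ∑' g, (p (g * s) - p g) < ((1 / ((n : ℝ≥0) + 1) : ℝ≥0) : ℝ≥0∞) :=
    fun n => H _ (by positivity)
  choose p hp1 hp using H'
  -- The displacement concerns right translation, while amenability asks for left invariance; hence
  -- the inversion. An ultrafilter limit of these masses exists by compactness and will be the
  -- invariant mean.
  let a : Set Γ → ℕ → ℝ≥0∞ := fun A n => ∑' g, Set.indicator {k : Γ | k⁻¹ ∈ A} (p n) g
  have hlim : ∀ A : Set Γ, ∃ x, Tendsto (a A) (hyperfilter ℕ) (nhds x) :=
    fun A => ⟨_, Ultrafilter.le_nhds_lim ((hyperfilter ℕ).map (a A))⟩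
  choose m hm using hlim
  -- The truncated difference controls one direction only; the reverse inequality comes from `g⁻¹`.
  have hle : ∀ g ∈ S, ∀ A : Set Γ, m ((fun x => g * x) '' A) ≤ m A := by
    intro g hg A
    have h0 : Tendsto (fun n : ℕ => ((1 / ((n : ℝ≥0) + 1) : ℝ≥0) : ℝ≥0∞)) (hyperfilter ℕ)
        (nhds 0) := by
      have h1 : Tendsto (fun n : ℕ => 1 / ((n : ℝ≥0) + 1)) atTop (nhds 0) :=
        tendsto_one_div_add_atTop_nhds_zero_nat
      have h2 := (ENNReal.tendsto_coe.2 h1).mono_left Nat.hyperfilter_le_atTop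
      simpa using h2
    have h1 := (hm A).add h0
    rw [add_zero] at h1
    refine le_of_tendsto_of_tendsto' (hm _) h1 fun n => ?_
    calc a ((fun x => g * x) '' A) n
        = ∑' k, Set.indicator {k : Γ | k⁻¹ ∈ (fun x => g * x) '' A} (p n) (k * g⁻¹) :=
          ((Equiv.mulRight g⁻¹).tsum_eq _).symm
      _ ≤ ∑' k, (Set.indicator {k : Γ | k⁻¹ ∈ A} (p n) k + (p n (k * g⁻¹) - p n k)) := by
          refine ENNReal.tsum_le_tsum fun k => ?_
          by_cases hk : k⁻¹ ∈ A
          · have hk' : (k * g⁻¹)⁻¹ ∈ (fun x => g * x) '' A := ⟨k⁻¹, hk, by simp⟩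
            rw [Set.indicator_of_mem (by exact hk'), Set.indicator_of_mem (by exact hk)]
            exact le_add_tsub
          · have hk' : (k * g⁻¹)⁻¹ ∉ (fun x => g * x) '' A := by
              rintro ⟨y, hy, hyk⟩
              apply hk
              have : g * y = g * k⁻¹ := by simpa using hyk
              rwa [← mul_left_cancel this]
            rw [Set.indicator_of_notMem (by exact hk')]
            exact zero_le
      _ = a A n + ∑' k, (p n (k * g⁻¹) - p n k) := ENNReal.tsum_add
      _ ≤ _ := by
          gcongr
          exact (hp n _ (hSsymm g hg)).le
  have hcomp : ∀ (g h : Γ) (A : Set Γ),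
      (fun x => g * x) '' ((fun x => h * x) '' A) = (fun x => (g * h) * x) '' A := by
    intro g h A
    rw [Set.image_image]
    simp [mul_assoc]
  have heq : ∀ g ∈ S, ∀ A : Set Γ, m ((fun x => g * x) '' A) = m A := by
    intro g hg A
    refine le_antisymm (hle g hg A) ?_
    have := hle _ (hSsymm g hg) ((fun x => g * x) '' A)
    rw [hcomp] at this
    simpa using this
  refine ⟨m, ?_, ?_, ?_⟩
  · have h1 : a Set.univ = fun _ => 1 := by
      funext n
      simp [a, hp1]
    have h2 := hm Set.univ
    rw [h1] at h2
    exact tendsto_nhds_unique h2 tendsto_const_nhds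
  · intro s t hst
    have h1 : a (s ∪ t) = fun n => a s n + a t n := by
      funext n
      simp only [a]
      rw [← ENNReal.tsum_add]
      refine tsum_congr fun g => ?_
      have hd : Disjoint {k : Γ | k⁻¹ ∈ s} {k : Γ | k⁻¹ ∈ t} :=
        Set.disjoint_left.2 fun k h1 h2 => Set.disjoint_left.1 hst h1 h2
      exact congrFun (Set.indicator_union_of_disjoint hd (p n)) g
    have h2 := hm (s ∪ t)
    rw [h1] at h2
    exact tendsto_nhds_unique h2 ((hm s).add (hm t))
  · intro g
    have hg : g ∈ Subgroup.closure S := hSgen ▸ Subgroup.mem_top g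
    induction hg using Subgroup.closure_induction with
    | mem x hx => exact heq x hx
    | one => intro A; simp
    | mul x y _ _ hx hy =>
      intro A
      rw [← hcomp, hx, hy]
    | inv x _ hx =>
      intro A
      rw [← hx, hcomp]
      simp

/-- Weighted AM-GM on `(a - b) * (a + b)`. The weight `δ / 4` is chosen so that, after summation,
the last term is half of the lower bound `δ * F` and can be absorbed. -/
theorem NNReal.sq_tsub_sq_le {a b δ : ℝ≥0} (hδ : 0 < δ) :
    a ^ 2 - b ^ 2 ≤ 2 / δ * (a - b) ^ 2 + δ / 4 * (a ^ 2 + b ^ 2) := by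
  rcases le_total a b with h | h
  · rw [tsub_eq_zero_of_le (pow_le_pow_left' h 2)]
    exact zero_le
  · rw [← NNReal.coe_le_coe]
    push_cast [NNReal.coe_sub h, NNReal.coe_sub (pow_le_pow_left' h 2)]
    have hδ' : (0 : ℝ) < δ := hδ
    have key : 2 / (δ : ℝ) * (a - b) ^ 2 + δ / 4 * (a ^ 2 + b ^ 2) - (a ^ 2 - b ^ 2)
        = (4 * (a - b) - δ * (a + b)) ^ 2 / (8 * δ) + δ / 8 * (a - b) ^ 2 := by
      field_simp
      ring
    have : 0 ≤ (4 * (a - b) - δ * (a + b) : ℝ) ^ 2 / (8 * δ) + δ / 8 * (a - b : ℝ) ^ 2 := by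
      positivity
    linarith

/-- The variance of a finite family is bounded below by the difference of two of its terms. -/
theorem NNReal.sq_average_add_le {ι : Type*} (T : Finset ι) (x : ι → ℝ≥0) {i j : ι}
    (hi : i ∈ T) (hj : j ∈ T) :
    ((T.card : ℝ≥0)⁻¹ * ∑ s ∈ T, x s) ^ 2 + (2 * (T.card : ℝ≥0))⁻¹ * (x i - x j) ^ 2 ≤
      (T.card : ℝ≥0)⁻¹ * ∑ s ∈ T, x s ^ 2 := by
  classical
  have hN : (0 : ℝ) < T.card := by exact_mod_cast Finset.card_pos.2 ⟨i, hi⟩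
  rw [← NNReal.coe_le_coe]
  push_cast
  set N : ℝ := (T.card : ℝ)
  set m : ℝ := N⁻¹ * ∑ s ∈ T, (x s : ℝ) with hm
  have hsum : ∑ s ∈ T, (x s : ℝ) = N * m := by rw [hm]; field_simp
  have hvar : ∑ s ∈ T, ((x s : ℝ) - m) ^ 2 = ∑ s ∈ T, (x s : ℝ) ^ 2 - N * m ^ 2 := by
    simp only [sub_sq, Finset.sum_add_distrib, Finset.sum_sub_distrib, Finset.sum_const,
      nsmul_eq_mul, ← Finset.sum_mul, ← Finset.mul_sum, hsum]
    ring
  have hd : (((x i - x j : ℝ≥0) : ℝ)) ^ 2 / 2 ≤ ∑ s ∈ T, ((x s : ℝ) - m) ^ 2 := by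
    have h0 : 0 ≤ ∑ s ∈ T, ((x s : ℝ) - m) ^ 2 := Finset.sum_nonneg fun _ _ => sq_nonneg _
    rcases le_total (x i) (x j) with h | h
    · rw [tsub_eq_zero_of_le h]
      simpa using h0
    · rw [NNReal.coe_sub h]
      by_cases hij : i = j
      · subst hij
        simpa using h0
      · have h1 : ∑ s ∈ {i, j}, ((x s : ℝ) - m) ^ 2 ≤ ∑ s ∈ T, ((x s : ℝ) - m) ^ 2 :=
          Finset.sum_le_sum_of_subset_of_nonneg (by
            intro k hk
            rcases Finset.mem_insert.1 hk with rfl | hk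
            · exact hi
            · rwa [Finset.mem_singleton.1 hk]) fun _ _ _ => sq_nonneg _
        rw [Finset.sum_pair hij] at h1
        -- This is `(u - v) ^ 2 / 2 ≤ u ^ 2 + v ^ 2` for the two deviations from the mean.
        nlinarith [sq_nonneg ((x i : ℝ) - m + (x j - m))]
  have : m ^ 2 + (2 * N)⁻¹ * ((x i - x j : ℝ≥0) : ℝ) ^ 2
      = N⁻¹ * (N * m ^ 2 + ((x i - x j : ℝ≥0) : ℝ) ^ 2 / 2) := by field_simp
  rw [this]
  exact mul_le_mul_of_nonneg_left (by linarith) (inv_nonneg.2 hN.le)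

/-- Kesten's theorem: in a non-amenable group, the averaging operator over a finite set containing
a symmetric generating set and the identity is a strict contraction of `ℓ²`. -/
theorem exists_l2_contraction {Γ : Type*} [Group Γ]
    (hΓ : ¬ IsAmenableGroup Γ) {S : Set Γ} (hSsymm : ∀ s ∈ S, s⁻¹ ∈ S)
    (hSgen : Subgroup.closure S = ⊤) (T : Finset Γ) (h1T : 1 ∈ T) (hST : ∀ s ∈ S, s ∈ T) :
    ∃ ρ : ℝ≥0, ρ < 1 ∧ ∀ f : Γ → ℝ≥0∞,
      ∑' g, ((T.card : ℝ≥0∞)⁻¹ * ∑ s ∈ T, f (g * s)) ^ 2 ≤ ρ * ∑' g, f g ^ 2 := by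
  obtain ⟨δ, hδ, hgap⟩ := exists_displacement_of_not_isAmenableGroup hΓ hSsymm hSgen
  have hN0 : 0 < T.card := Finset.card_pos.2 ⟨1, h1T⟩
  have hN : (0 : ℝ≥0) < T.card := by exact_mod_cast hN0
  -- The `1 / 2` only keeps the constant positive, which settles the case of infinite norm.
  refine ⟨max (1 / 2) (1 - δ ^ 2 / (8 * T.card)), max_lt (by
    rw [← NNReal.coe_lt_coe]; norm_num) (tsub_lt_self one_pos (by positivity)), fun f => ?_⟩
  set F := ∑' g, f g ^ 2 with hF
  rcases eq_or_ne F ∞ with hFt | hFt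
  · rw [hFt, ENNReal.mul_top]
    · exact le_top
    · have : (0 : ℝ≥0) < max (1 / 2) (1 - δ ^ 2 / (8 * T.card)) :=
        lt_max_of_lt_left (by positivity)
      exact_mod_cast this.ne'
  rcases eq_or_ne F 0 with hF0 | hF0
  · have hf : ∀ g, f g = 0 := by simpa [hF] using hF0
    simp [hf]
  have hfin : ∀ g, f g ≠ ∞ := by
    intro g hg
    apply hFt
    have h1 : f g ^ 2 ≤ F := ENNReal.le_tsum g
    rw [hg] at h1
    simpa using h1
  lift f to Γ → ℝ≥0 using hfin
  replace hF : F = ∑' g, (f g : ℝ≥0∞) ^ 2 := hF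
  -- The `ℓ¹` displacement of the probability vector `f ^ 2 / F` forces an `ℓ²` displacement `D ≥ δ
  -- ^ 2 / 4 * F` of `f`.
  obtain ⟨s, hs, hds⟩ := hgap (fun g => F⁻¹ * (f g : ℝ≥0∞) ^ 2) (by
    rw [ENNReal.tsum_mul_left, ← hF, ENNReal.inv_mul_cancel hF0 hFt])
  set D : ℝ≥0∞ := ∑' g, ((f (g * s) - f g : ℝ≥0) : ℝ≥0∞) ^ 2 with hD
  have htrans : ∀ t : Γ, ∑' g, (f (g * t) : ℝ≥0∞) ^ 2 = F := fun t =>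
    (Equiv.mulRight t).tsum_eq fun g => (f g : ℝ≥0∞) ^ 2
  have hA : δ * F ≤ ∑' g, ((f (g * s) : ℝ≥0∞) ^ 2 - (f g : ℝ≥0∞) ^ 2) := by
    simp only [← ENNReal.mul_sub (fun _ _ => ENNReal.inv_ne_top.2 hF0)] at hds
    rw [ENNReal.tsum_mul_left] at hds
    calc δ * F ≤ F⁻¹ * (∑' g, ((f (g * s) : ℝ≥0∞) ^ 2 - (f g : ℝ≥0∞) ^ 2)) * F := by gcongr
      _ = _ := by rw [mul_comm, ← mul_assoc, ENNReal.mul_inv_cancel hF0 hFt, one_mul]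
  have hB : δ * F ≤ (2 / δ : ℝ≥0) * D + (δ / 4 : ℝ≥0) * (F + F) := by
    refine hA.trans ?_
    nth_rewrite 1 [← htrans s]
    rw [hF, hD, ← ENNReal.tsum_add, ← ENNReal.tsum_mul_left, ← ENNReal.tsum_mul_left,
      ← ENNReal.tsum_add]
    refine ENNReal.tsum_le_tsum fun g => ?_
    exact_mod_cast NNReal.sq_tsub_sq_le (a := f (g * s)) (b := f g) hδ
  -- The average loses the variance of `t ↦ f (g * t)`, bounded below by comparing `t = s` with `t =
  -- 1`.
  have hC : ∑' g, ((T.card : ℝ≥0∞)⁻¹ * ∑ t ∈ T, (f (g * t) : ℝ≥0∞)) ^ 2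
      + ((2 * (T.card : ℝ≥0))⁻¹ : ℝ≥0) * D ≤ F := by
    have hF' : F = ((T.card : ℝ≥0)⁻¹ : ℝ≥0) * ∑ t ∈ T, ∑' g, (f (g * t) : ℝ≥0∞) ^ 2 := by
      simp only [htrans, Finset.sum_const, nsmul_eq_mul]
      rw [← mul_assoc]
      have : ((T.card : ℝ≥0)⁻¹ : ℝ≥0) * (T.card : ℝ≥0∞) = 1 := by
        exact_mod_cast inv_mul_cancel₀ hN.ne'
      rw [this, one_mul]
    rw [hF', ← Summable.tsum_finsetSum (fun _ _ => ENNReal.summable), hD,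
      ← ENNReal.tsum_mul_left, ← ENNReal.tsum_mul_left, ← ENNReal.tsum_add]
    refine ENNReal.tsum_le_tsum fun g => ?_
    have h := NNReal.sq_average_add_le T (fun t => f (g * t)) (hST s hs) h1T
    rw [mul_one] at h
    have hinv : (T.card : ℝ≥0∞)⁻¹ = ((T.card : ℝ≥0)⁻¹ : ℝ≥0) := by
      rw [ENNReal.coe_inv hN.ne']
      simp
    rw [hinv]
    exact_mod_cast h
  set A := ∑' g, ((T.card : ℝ≥0∞)⁻¹ * ∑ t ∈ T, (f (g * t) : ℝ≥0∞)) ^ 2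
  have hAt : A ≠ ∞ := ne_top_of_le_ne_top hFt (le_self_add.trans hC)
  have hDt : D ≠ ∞ := by
    refine ne_top_of_le_ne_top hFt ?_
    rw [hD, ← htrans s]
    refine ENNReal.tsum_le_tsum fun g => ?_
    gcongr
    exact tsub_le_self
  refine le_trans ?_ (mul_le_mul_left (ENNReal.coe_le_coe.2 (le_max_right _ _)) F)
  clear_value A D F
  lift A to ℝ≥0 using hAt
  lift D to ℝ≥0 using hDt
  lift F to ℝ≥0 using hFt
  norm_cast at hB hC ⊢
  have hρ : (1 : ℝ) - δ ^ 2 / (8 * T.card) ≤ ((1 - δ ^ 2 / (8 * T.card) : ℝ≥0) : ℝ) := by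
    have := NNReal.coe_le_coe.2 (le_tsub_add (a := δ ^ 2 / (8 * (T.card : ℝ≥0))) (b := 1))
    push_cast at this
    linarith
  rw [← NNReal.coe_le_coe] at hB hC ⊢
  push_cast at hB hC ⊢
  have hδ' : (0 : ℝ) < δ := hδ
  have hN' : (0 : ℝ) < T.card := hN
  refine le_trans ?_ (mul_le_mul_of_nonneg_right hρ F.2)
  have hD' : (δ : ℝ) ^ 2 / 4 * F ≤ D := by
    have h1 : (δ : ℝ) / 2 * F ≤ 2 / δ * D := by linarith
    calc (δ : ℝ) ^ 2 / 4 * F = δ / 2 * (δ / 2 * F) := by ring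
      _ ≤ δ / 2 * (2 / δ * D) := by gcongr
      _ = D := by field_simp
  have h2 : (2 * (T.card : ℝ))⁻¹ * ((δ : ℝ) ^ 2 / 4 * F) ≤ (2 * (T.card : ℝ))⁻¹ * D := by gcongr
  have h3 : (2 * (T.card : ℝ))⁻¹ * ((δ : ℝ) ^ 2 / 4 * F) = δ ^ 2 / (8 * T.card) * F := by
    field_simp
    ring
  change (A : ℝ) ≤ (1 - (δ : ℝ) ^ 2 / (8 * T.card)) * F
  linarith

/-- On a finite group the uniform vector is not displaced at all. -/
theorem infinite_of_not_isAmenableGroup {Γ : Type*} [Group Γ] (hΓ : ¬ IsAmenableGroup Γ)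
    {S : Set Γ} (hSsymm : ∀ s ∈ S, s⁻¹ ∈ S) (hSgen : Subgroup.closure S = ⊤) : Infinite Γ := by
  by_contra hfin
  rw [not_infinite_iff_finite] at hfin
  have := Fintype.ofFinite Γ
  obtain ⟨δ, hδ, h⟩ := exists_displacement_of_not_isAmenableGroup hΓ hSsymm hSgen
  obtain ⟨s, -, hs⟩ := h (fun _ => (Fintype.card Γ : ℝ≥0∞)⁻¹) (by
    rw [tsum_fintype, Finset.sum_const, nsmul_eq_mul, Finset.card_univ]
    exact ENNReal.mul_inv_cancel (by simp) (by simp))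
  simp at hs
  exact hδ.ne' hs

/-! ### Word distance and geodesics -/

section WordMetric

variable {Γ : Type*} [Group Γ] {S : Set Γ}

theorem reachable_mulCayley_mul_left {x y : Γ} (g : Γ)
    (h : (SimpleGraph.mulCayley S).Reachable x y) :
    (SimpleGraph.mulCayley S).Reachable (g * x) (g * y) := by
  obtain ⟨p⟩ := h
  exact ⟨p.map ⟨fun x => g * x, fun h => SimpleGraph.mulCayley_adj_mul_iff_right.2 h⟩⟩

/-- Connectedness excludes the default value `0` of `SimpleGraph.dist` on unreachable pairs. -/
theorem connected_mulCayley (hSgen : Subgroup.closure S = ⊤) :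
    (SimpleGraph.mulCayley S).Connected := by
  have h1 : ∀ g : Γ, (SimpleGraph.mulCayley S).Reachable 1 g := by
    intro g
    have hg : g ∈ Subgroup.closure S := hSgen ▸ Subgroup.mem_top g
    induction hg using Subgroup.closure_induction with
    | mem x hx =>
      by_cases h : (1 : Γ) = x
      · rw [h]
      · exact SimpleGraph.Adj.reachable ((SimpleGraph.mulCayley_adj S 1 x).2 ⟨h, by simp [hx]⟩)
    | one => rfl
    | mul x y _ _ hx hy =>
      have := reachable_mulCayley_mul_left x hy
      rw [mul_one] at this
      exact hx.trans this
    | inv x _ hx =>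
      have := reachable_mulCayley_mul_left x⁻¹ hx
      rw [mul_one, inv_mul_cancel] at this
      exact this.symm
  exact { preconnected := fun x y => (h1 x).symm.trans (h1 y), nonempty := ⟨1⟩ }

theorem wordDist_mul_left (hSgen : Subgroup.closure S = ⊤) (g x y : Γ) :
    wordDist S (g * x) (g * y) = wordDist S x y := by
  have key : ∀ g x y : Γ, wordDist S (g * x) (g * y) ≤ wordDist S x y := by
    intro g x y
    obtain ⟨p, hp⟩ := (connected_mulCayley hSgen).exists_walk_length_eq_dist x y
    let φ : SimpleGraph.mulCayley S →g SimpleGraph.mulCayley S :=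
      ⟨fun x => g * x, fun h => SimpleGraph.mulCayley_adj_mul_iff_right.2 h⟩
    refine (SimpleGraph.dist_le (p.map φ)).trans ?_
    rw [SimpleGraph.Walk.length_map, hp]
    rfl
  refine le_antisymm (key g x y) ?_
  simpa using key g⁻¹ (g * x) (g * y)

theorem wordDist_triangle (hSgen : Subgroup.closure S = ⊤) (x y z : Γ) :
    wordDist S x z ≤ wordDist S x y + wordDist S y z :=
  (connected_mulCayley hSgen).dist_triangle

theorem wordDist_one_mul_le (hSgen : Subgroup.closure S = ⊤) (g h : Γ) :
    wordDist S 1 (g * h) ≤ wordDist S 1 g + wordDist S 1 h := by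
  refine (wordDist_triangle hSgen 1 g (g * h)).trans ?_
  have := wordDist_mul_left hSgen g 1 h
  rw [mul_one] at this
  rw [this]

theorem wordDist_one_inv_mul (hSgen : Subgroup.closure S = ⊤) (x y : Γ) :
    wordDist S 1 (x⁻¹ * y) = wordDist S x y := by
  simpa using (wordDist_mul_left hSgen x 1 (x⁻¹ * y)).symm

theorem wordDist_one_inv (hSgen : Subgroup.closure S = ⊤) (g : Γ) :
    wordDist S 1 g⁻¹ = wordDist S 1 g := by
  have := wordDist_one_inv_mul hSgen g 1
  rw [mul_one] at this
  rw [this]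
  exact SimpleGraph.dist_comm

theorem wordDist_self (x : Γ) : wordDist S x x = 0 := SimpleGraph.dist_self

theorem wordDist_one_le_one {s : Γ} (hs : s ∈ insert 1 S) : wordDist S 1 s ≤ 1 := by
  by_cases h : (1 : Γ) = s
  · rw [← h, wordDist_self]
    exact zero_le_one
  · have hs' : s ∈ S := hs.resolve_left fun h' => h h'.symm
    have : (SimpleGraph.mulCayley S).Adj 1 s :=
      (SimpleGraph.mulCayley_adj S 1 s).2 ⟨h, by simp [hs']⟩
    exact (SimpleGraph.dist_eq_one_iff_adj.2 this).le

theorem finite_setOf_walk_length_eq (hSfin : S.Finite) (hSsymm : ∀ s ∈ S, s⁻¹ ∈ S) (n : ℕ) :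
    ∀ x : Γ, {y | ∃ p : (SimpleGraph.mulCayley S).Walk x y, p.length = n}.Finite := by
  induction n with
  | zero =>
    intro x
    refine (Set.finite_singleton x).subset ?_
    rintro y ⟨p, hp⟩
    exact (SimpleGraph.Walk.eq_of_length_eq_zero hp).symm
  | succ n ih =>
    intro x
    refine (hSfin.biUnion fun s _ => ih (x * s)).subset ?_
    rintro y ⟨p, hp⟩
    cases p with
    | nil => simp at hp
    | @cons _ v _ hadj q =>
      have hq : q.length = n := by simpa using hp
      have hv : x⁻¹ * v ∈ S := by
        rcases ((SimpleGraph.mulCayley_adj S x v).1 hadj).2 with h | h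
        · exact h
        · simpa using hSsymm _ h
      refine Set.mem_biUnion hv ?_
      have : x * (x⁻¹ * v) = v := mul_inv_cancel_left x v
      rw [this]
      exact ⟨q, hq⟩

theorem exists_le_wordDist_one [Infinite Γ] (hSfin : S.Finite) (hSsymm : ∀ s ∈ S, s⁻¹ ∈ S)
    (hSgen : Subgroup.closure S = ⊤) (n : ℕ) : ∃ g : Γ, n ≤ wordDist S 1 g := by
  by_contra! H
  refine Set.infinite_univ (α := Γ) (((Set.finite_Iio n).biUnion fun k _ =>
    finite_setOf_walk_length_eq hSfin hSsymm k 1).subset fun g _ => ?_)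
  obtain ⟨p, hp⟩ := (connected_mulCayley hSgen).exists_walk_length_eq_dist 1 g
  exact Set.mem_biUnion (H g) ⟨p, hp⟩

theorem exists_orderedOnGeodesic [Infinite Γ] (hSfin : S.Finite) (hSsymm : ∀ s ∈ S, s⁻¹ ∈ S)
    (hSgen : Subgroup.closure S = ⊤) (n : ℕ) :
    ∃ y z : Γ, OrderedOnGeodesic S 1 y z ∧ wordDist S 1 y = n ∧ wordDist S y z = n ∧
      wordDist S 1 z = 2 * n := by
  obtain ⟨g, hg⟩ := exists_le_wordDist_one hSfin hSsymm hSgen (2 * n)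
  obtain ⟨p, hp⟩ := (connected_mulCayley hSgen).exists_walk_length_eq_dist 1 g
  have hup : ∀ i k : ℕ, i + k ≤ p.length → wordDist S (p.getVert i) (p.getVert (i + k)) ≤ k := by
    intro i k
    induction k with
    | zero => intro _; simp [wordDist_self]
    | succ k ih =>
      intro hk
      refine (wordDist_triangle hSgen _ (p.getVert (i + k)) _).trans ?_
      have h1 : wordDist S (p.getVert (i + k)) (p.getVert (i + (k + 1))) = 1 :=
        SimpleGraph.dist_eq_one_iff_adj.2 (p.adj_getVert_succ (by omega))
      have h2 := ih (by omega)
      omega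
  -- A shortest walk is geodesic between any two of its vertices: a shortcut would contradict
  -- minimality through the triangle inequality.
  have hgeo : ∀ i j : ℕ, i ≤ j → j ≤ p.length →
      wordDist S (p.getVert i) (p.getVert j) = j - i := by
    intro i j hij hj
    have h1 := hup i (j - i) (by omega)
    have h2 := hup 0 i (by omega)
    have h3 := hup j (p.length - j) (by omega)
    rw [Nat.add_sub_cancel' hij] at h1
    rw [Nat.add_sub_cancel' hj, p.getVert_length] at h3
    rw [zero_add, p.getVert_zero] at h2
    have h4 := wordDist_triangle hSgen 1 (p.getVert i) g
    have h5 := wordDist_triangle hSgen (p.getVert i) (p.getVert j) g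
    have h6 : wordDist S 1 g = p.length := hp.symm
    omega
  have hL : 2 * n ≤ p.length := hg.trans_eq hp.symm
  have h0 := p.getVert_zero
  refine ⟨p.getVert n, p.getVert (2 * n), ⟨p.length, p.getVert, hgeo, 0, n, 2 * n, by omega,
    by omega, hL, h0, rfl, rfl⟩, ?_, ?_, ?_⟩
  · simpa [h0] using hgeo 0 n (by omega) (by omega)
  · rw [hgeo n (2 * n) (by omega) (by omega)]
    omega
  · simpa [h0] using hgeo 0 (2 * n) (by omega) (by omega)

end WordMetric

/-! ### Convolution on `ℓ²` and weighted Green function bounds -/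

/-- The uniform probability on a finite set. -/
noncomputable def uniformOn {Γ : Type*} (T : Finset Γ) : Γ → ℝ≥0∞ :=
  Set.indicator (T : Set Γ) fun _ => (T.card : ℝ≥0∞)⁻¹

theorem tsum_uniformOn {Γ : Type*} {T : Finset Γ} (hT : T.Nonempty) : ∑' g, uniformOn T g = 1 := by
  classical
  have h : ∑' g, uniformOn T g = ∑ g ∈ T, uniformOn T g :=
    tsum_eq_sum fun g hg => Set.indicator_of_notMem (by simpa using hg) _
  have h' : ∑ g ∈ T, uniformOn T g = ∑ g ∈ T, (T.card : ℝ≥0∞)⁻¹ :=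
    Finset.sum_congr rfl fun g hg => Set.indicator_of_mem (by simpa using hg) _
  rw [h, h', Finset.sum_const, nsmul_eq_mul]
  exact ENNReal.mul_inv_cancel (by simpa using hT.ne_empty) (by simp)

section Convolution

variable {Γ : Type*} [Group Γ]

/-- The convolution of two nonnegative functions on a discrete group. -/
noncomputable def convolve (f ν : Γ → ℝ≥0∞) (g : Γ) : ℝ≥0∞ := ∑' h, f h * ν (h⁻¹ * g)

theorem convolve_eq_tsum (f ν : Γ → ℝ≥0∞) (g : Γ) :
    convolve f ν g = ∑' s, f (g * s⁻¹) * ν s := by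
  rw [convolve, ← ((Equiv.inv Γ).trans (Equiv.mulLeft g)).tsum_eq]
  simp

theorem convolve_mono_right (f : Γ → ℝ≥0∞) {ν ν' : Γ → ℝ≥0∞} (h : ∀ g, ν g ≤ ν' g) (g : Γ) :
    convolve f ν g ≤ convolve f ν' g :=
  ENNReal.tsum_le_tsum fun _ => mul_le_mul_right (h _) _

theorem ENNReal.two_mul_mul_le_add_sq (a b : ℝ≥0∞) : 2 * (a * b) ≤ a ^ 2 + b ^ 2 := by
  rcases eq_or_ne a ∞ with rfl | ha
  · simp
  rcases eq_or_ne b ∞ with rfl | hb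
  · simp
  lift a to ℝ≥0 using ha
  lift b to ℝ≥0 using hb
  norm_cast
  rw [← mul_assoc]
  exact two_mul_le_add_sq a b

/-- A small `t` keeps the factor of the main term near `1`, at the cost of a large factor on the
perturbation. -/
theorem ENNReal.add_sq_le (a b : ℝ≥0∞) {t : ℝ≥0} (ht : 0 < t) :
    (a + b) ^ 2 ≤ (1 + t : ℝ≥0) * a ^ 2 + (1 + t⁻¹ : ℝ≥0) * b ^ 2 := by
  rcases eq_or_ne a ∞ with rfl | ha
  · simp
  rcases eq_or_ne b ∞ with rfl | hb
  · simp
  lift a to ℝ≥0 using ha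
  lift b to ℝ≥0 using hb
  norm_cast
  rw [← NNReal.coe_le_coe]
  push_cast
  have ht' : (0 : ℝ) < t := ht
  have h : (1 + t : ℝ) * a ^ 2 + (1 + (t : ℝ)⁻¹) * b ^ 2 - (a + b) ^ 2
      = (t : ℝ)⁻¹ * (t * a - b) ^ 2 := by
    field_simp
    ring
  have : 0 ≤ (t : ℝ)⁻¹ * (t * a - b) ^ 2 := by positivity
  linarith

/-- Cauchy–Schwarz (or Jensen) inequality for a weighted sum. -/
theorem ENNReal.sq_tsum_mul_le {ι : Type*} (a τ : ι → ℝ≥0∞) :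
    (∑' s, a s * τ s) ^ 2 ≤ (∑' s, τ s) * ∑' s, a s ^ 2 * τ s := by
  have hdouble : ∀ x y : ι → ℝ≥0∞, (∑' s, x s) * (∑' t, y t) = ∑' s, ∑' t, x s * y t := by
    intro x y
    rw [← ENNReal.tsum_mul_right]
    simp only [ENNReal.tsum_mul_left]
  -- Expand the square as a double sum and use `2 * (a s * a t) ≤ a s ^ 2 + a t ^ 2`.
  have h : 2 * (∑' s, a s * τ s) ^ 2 ≤ 2 * ((∑' s, τ s) * ∑' s, a s ^ 2 * τ s) := by
    calc 2 * (∑' s, a s * τ s) ^ 2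
        = ∑' s, ∑' t, 2 * (a s * a t) * (τ s * τ t) := by
          rw [sq, hdouble, ← ENNReal.tsum_mul_left]
          refine tsum_congr fun s => ?_
          rw [← ENNReal.tsum_mul_left]
          exact tsum_congr fun t => by ring
      _ ≤ ∑' s, ∑' t, (a s ^ 2 * τ s * τ t + τ s * (a t ^ 2 * τ t)) := by
          refine ENNReal.tsum_le_tsum fun s => ENNReal.tsum_le_tsum fun t => ?_
          refine (mul_le_mul_left (ENNReal.two_mul_mul_le_add_sq (a s) (a t)) _).trans_eq ?_
          ring
      _ = _ := by
          simp only [ENNReal.tsum_add]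
          rw [← hdouble, ← hdouble, two_mul, mul_comm (∑' s, a s ^ 2 * τ s)]
  exact (ENNReal.mul_le_mul_iff_right (by simp) (by simp)).1 h

/-- Young's inequality `‖f * τ‖₂ ≤ ‖τ‖₁ ‖f‖₂`. -/
theorem tsum_sq_convolve_le (f τ : Γ → ℝ≥0∞) :
    ∑' g, convolve f τ g ^ 2 ≤ (∑' g, τ g) ^ 2 * ∑' g, f g ^ 2 := by
  calc ∑' g, convolve f τ g ^ 2
      ≤ ∑' g, (∑' s, τ s) * ∑' s, f (g * s⁻¹) ^ 2 * τ s := by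
        refine ENNReal.tsum_le_tsum fun g => ?_
        rw [convolve_eq_tsum]
        exact ENNReal.sq_tsum_mul_le (fun s => f (g * s⁻¹)) τ
    _ = (∑' s, τ s) * ∑' s, (∑' g, f g ^ 2) * τ s := by
        rw [ENNReal.tsum_mul_left, ENNReal.tsum_comm]
        congr 1
        refine tsum_congr fun s => ?_
        rw [ENNReal.tsum_mul_right]
        congr 1
        exact (Equiv.mulRight s⁻¹).tsum_eq fun g => f g ^ 2
    _ = _ := by
        rw [ENNReal.tsum_mul_left]
        ring

theorem convolve_uniformOn (f : Γ → ℝ≥0∞) {T : Finset Γ} (hT : ∀ s ∈ T, s⁻¹ ∈ T) (g : Γ) :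
    convolve f (uniformOn T) g = (T.card : ℝ≥0∞)⁻¹ * ∑ s ∈ T, f (g * s) := by
  rw [convolve_eq_tsum, tsum_eq_sum (s := T) fun s hs => by
    rw [uniformOn, Set.indicator_of_notMem (by simpa using hs), mul_zero], Finset.mul_sum]
  refine Finset.sum_bij' (fun s _ => s⁻¹) (fun s _ => s⁻¹) hT hT (by simp) (by simp) ?_
  intro s hs
  rw [uniformOn, Set.indicator_of_mem (by simpa using hs), mul_comm]

theorem convolve_add_right (f ν ν' : Γ → ℝ≥0∞) (g : Γ) :
    convolve f (fun x => ν x + ν' x) g = convolve f ν g + convolve f ν' g := by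
  simp only [convolve, mul_add, ENNReal.tsum_add]

theorem convolve_const_mul_right (c : ℝ≥0∞) (f ν : Γ → ℝ≥0∞) (g : Γ) :
    convolve f (fun x => c * ν x) g = c * convolve f ν g := by
  simp only [convolve, ← ENNReal.tsum_mul_left]
  exact tsum_congr fun h => by ring

/-- The Dirac mass has `ℓ²` norm `1`, each convolution costs a factor `r`, and values are bounded by
the `ℓ²` norm. -/
theorem convPow_le_pow {ν : Γ → ℝ≥0∞} {r : ℝ≥0∞}
    (hν : ∀ f : Γ → ℝ≥0∞, ∑' g, convolve f ν g ^ 2 ≤ r ^ 2 * ∑' g, f g ^ 2) (n : ℕ) (g : Γ) :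
    convPow ν n g ≤ r ^ n := by
  have h : ∑' g, convPow ν n g ^ 2 ≤ (r ^ n) ^ 2 := by
    induction n with
    | zero => simp [convPow, ite_pow]
    | succ n ih =>
      refine (hν (convPow ν n)).trans ?_
      rw [pow_succ' r n, mul_pow]
      gcongr
  have h1 : convPow ν n g ^ 2 ≤ (r ^ n) ^ 2 := (ENNReal.le_tsum g).trans h
  exact (ENNReal.pow_le_pow_left_iff two_ne_zero).1 h1

/-- Submultiplicativity distributes the weight of the endpoint over the increments of each path. -/
theorem convPow_mul_le {μ W : Γ → ℝ≥0∞} (hW1 : W 1 ≤ 1) (hW : ∀ g h, W (g * h) ≤ W g * W h)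
    (n : ℕ) (g : Γ) : convPow μ n g * W g ≤ convPow (fun x => μ x * W x) n g := by
  induction n generalizing g with
  | zero =>
    by_cases hg : g = 1
    · simpa [convPow, hg] using hW1
    · simp [convPow, hg]
  | succ n ih =>
    simp only [convPow]
    rw [← ENNReal.tsum_mul_right]
    refine ENNReal.tsum_le_tsum fun h => ?_
    calc convPow μ n h * μ (h⁻¹ * g) * W g
        ≤ convPow μ n h * μ (h⁻¹ * g) * (W h * W (h⁻¹ * g)) := by
          gcongr
          simpa using hW h (h⁻¹ * g)
      _ = convPow μ n h * W h * (μ (h⁻¹ * g) * W (h⁻¹ * g)) := by ring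
      _ ≤ _ := mul_le_mul_left (ih h) _

/-- Sum of a geometric series; for `r ≥ 1` the right side is `∞`. -/
theorem green_mul_le {μ W : Γ → ℝ≥0∞} {r : ℝ≥0∞} (hW1 : W 1 ≤ 1)
    (hW : ∀ g h, W (g * h) ≤ W g * W h)
    (hμ : ∀ f : Γ → ℝ≥0∞, ∑' g, convolve f (fun x => μ x * W x) g ^ 2 ≤ r ^ 2 * ∑' g, f g ^ 2)
    (x y : Γ) : green μ x y * W (x⁻¹ * y) ≤ (1 - r)⁻¹ := by
  rw [green, ← ENNReal.tsum_mul_right, ← ENNReal.tsum_geometric]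
  exact ENNReal.tsum_le_tsum fun n => (convPow_mul_le hW1 hW n _).trans (convPow_le_pow hμ n _)

theorem le_green (μ : Γ → ℝ≥0∞) (x y : Γ) : μ (x⁻¹ * y) ≤ green μ x y := by
  refine le_trans ?_ (ENNReal.le_tsum 1)
  simp only [convPow]
  refine le_trans ?_ (ENNReal.le_tsum 1)
  simp

end Convolution

/-! ### The weight and the choice of parameters -/

/-- The submultiplicative weight `(1 + η) ^ n * (1 + η n)`. -/
noncomputable def polyExpWeight (η : ℝ≥0) (n : ℕ) : ℝ≥0 := (1 + η) ^ n * (1 + η * n)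

theorem polyExpWeight_zero (η : ℝ≥0) : polyExpWeight η 0 = 1 := by simp [polyExpWeight]

theorem polyExpWeight_one (η : ℝ≥0) : polyExpWeight η 1 = (1 + η) ^ 2 := by
  simp [polyExpWeight, sq]

theorem polyExpWeight_mono (η : ℝ≥0) : Monotone (polyExpWeight η) := by
  intro m n h
  unfold polyExpWeight
  gcongr
  exact le_self_add

theorem one_le_polyExpWeight (η : ℝ≥0) (n : ℕ) : 1 ≤ polyExpWeight η n :=
  (polyExpWeight_zero η).ge.trans (polyExpWeight_mono η n.zero_le)

theorem polyExpWeight_add_le (η : ℝ≥0) (m n : ℕ) :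
    polyExpWeight η (m + n) ≤ polyExpWeight η m * polyExpWeight η n := by
  have h : (1 + η * ((m + n : ℕ) : ℝ≥0)) ≤ (1 + η * m) * (1 + η * n) := by
    have : (1 + η * m) * (1 + η * n) = (1 + η * ((m + n : ℕ) : ℝ≥0)) + η * m * (η * n) := by
      push_cast
      ring
    rw [this]
    exact le_self_add
  calc polyExpWeight η (m + n) ≤ (1 + η) ^ (m + n) * ((1 + η * m) * (1 + η * n)) := by
        unfold polyExpWeight
        gcongr
    _ = _ := by
        unfold polyExpWeight
        ring

/-- The exponential factors cancel and the linear ones leave a gain of order `n`: this is what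
defeats Ancona. -/
theorem polyExpWeight_two_mul (η : ℝ≥0) (n : ℕ) :
    polyExpWeight η (2 * n) * (1 + η * n) ≤ 2 * polyExpWeight η n ^ 2 := by
  have h : (1 + η * ((2 * n : ℕ) : ℝ≥0)) ≤ 2 * (1 + η * n) := by
    have : 2 * (1 + η * n) = (1 + η * ((2 * n : ℕ) : ℝ≥0)) + 1 := by
      push_cast
      ring
    rw [this]
    exact le_self_add
  calc polyExpWeight η (2 * n) * (1 + η * n)
      ≤ (1 + η) ^ (2 * n) * (2 * (1 + η * n)) * (1 + η * n) := by
        unfold polyExpWeight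
        gcongr
    _ = _ := by
        unfold polyExpWeight
        ring

/-- In the power `5`, one factor comes from `add_sq_le` with `t = η`, and four from squaring the
weight `(1 + η) ^ 2` of a generator. First `η`, then `b`, is taken small. -/
theorem exists_contraction_parameters {ρ : ℝ≥0} (hρ : ρ < 1) :
    ∃ η b r : ℝ≥0, 0 < η ∧ 0 < b ∧ b ≤ 1 ∧ r < 1 ∧
      (1 + η) ^ 5 * ρ + (1 + η⁻¹) * b ^ 2 ≤ r ^ 2 := by
  have h1 : ∀ᶠ η : ℝ≥0 in nhdsWithin 0 (Set.Ioi 0), (1 + η) ^ 5 * ρ < 1 := by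
    have hc : Continuous fun η : ℝ≥0 => (1 + η) ^ 5 * ρ := by fun_prop
    exact ((hc.tendsto 0).mono_left nhdsWithin_le_nhds).eventually_lt_const (by simpa using hρ)
  obtain ⟨η, hη, hη0⟩ := (h1.and self_mem_nhdsWithin).exists
  have h2 : ∀ᶠ b : ℝ≥0 in nhdsWithin 0 (Set.Ioi 0),
      (1 + η) ^ 5 * ρ + (1 + η⁻¹) * b ^ 2 < 1 := by
    have hc : Continuous fun b : ℝ≥0 => (1 + η) ^ 5 * ρ + (1 + η⁻¹) * b ^ 2 := by fun_prop
    exact ((hc.tendsto 0).mono_left nhdsWithin_le_nhds).eventually_lt_const (by simpa using hη)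
  have h3 : ∀ᶠ b : ℝ≥0 in nhdsWithin 0 (Set.Ioi 0), b < 1 :=
    (tendsto_id.mono_left nhdsWithin_le_nhds).eventually_lt_const one_pos
  obtain ⟨b, ⟨hb, hb1⟩, hb0⟩ := ((h2.and h3).and self_mem_nhdsWithin).exists
  refine ⟨η, b, NNReal.sqrt ((1 + η) ^ 5 * ρ + (1 + η⁻¹) * b ^ 2), hη0, hb0, hb1.le, ?_, ?_⟩
  · simpa using NNReal.sqrt_lt_sqrt.2 hb
  · rw [NNReal.sq_sqrt]

/-! ### The jump measure, and criteria for admissibility, contraction and tails -/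

section Jumps

variable {Γ : Type*} [Group Γ]

open Classical in
/-- The symmetric measure with an atom of mass `c j` at `x j` and another one at `(x j)⁻¹`, for
each `j`. -/
noncomputable def jumpMeasure (x : ℕ → Γ) (c : ℕ → ℝ≥0∞) (g : Γ) : ℝ≥0∞ :=
  ∑' j, ((if g = x j then c j else 0) + if g = (x j)⁻¹ then c j else 0)

theorem jumpMeasure_inv (x : ℕ → Γ) (c : ℕ → ℝ≥0∞) (g : Γ) :
    jumpMeasure x c g⁻¹ = jumpMeasure x c g := by
  unfold jumpMeasure
  refine tsum_congr fun j => ?_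
  rw [add_comm]
  congr 2 <;> simp only [inv_eq_iff_eq_inv, inv_inv]

theorem le_jumpMeasure (x : ℕ → Γ) (c : ℕ → ℝ≥0∞) (j : ℕ) : c j ≤ jumpMeasure x c (x j) := by
  refine le_trans ?_ (ENNReal.le_tsum j)
  simp

theorem tsum_jumpMeasure_mul (x : ℕ → Γ) (c : ℕ → ℝ≥0∞) (F : Γ → ℝ≥0∞) :
    ∑' g, jumpMeasure x c g * F g = ∑' j, c j * (F (x j) + F (x j)⁻¹) := by
  simp only [jumpMeasure, ← ENNReal.tsum_mul_right]
  rw [ENNReal.tsum_comm]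
  refine tsum_congr fun j => ?_
  simp only [add_mul, ENNReal.tsum_add, ite_mul, zero_mul, mul_add]
  congr 1
  · rw [tsum_eq_single (x j) fun g hg => if_neg hg, if_pos rfl]
  · rw [tsum_eq_single (x j)⁻¹ fun g hg => if_neg hg, if_pos rfl]

end Jumps

theorem uniformOn_inv {Γ : Type*} [Group Γ] {T : Finset Γ} (hT : ∀ s ∈ T, s⁻¹ ∈ T) (g : Γ) :
    uniformOn T g⁻¹ = uniformOn T g := by
  unfold uniformOn
  by_cases hg : g ∈ T
  · rw [Set.indicator_of_mem (by simpa using hT g hg), Set.indicator_of_mem (by simpa using hg)]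
  · have hg' : g⁻¹ ∉ T := fun h => hg (by simpa using hT _ h)
    rw [Set.indicator_of_notMem (by simpa using hg'), Set.indicator_of_notMem (by simpa using hg)]

/-- Carrying `g` and `g⁻¹` together handles inversion; the identity has to come from the support, as
a semigroup closure does not supply it. -/
theorem isAdmissible_of_subset_support {Γ : Type*} [Group Γ] {S : Set Γ}
    (hSsymm : ∀ s ∈ S, s⁻¹ ∈ S) (hSgen : Subgroup.closure S = ⊤) {μ : PMF Γ}
    (hμ : insert 1 S ⊆ μ.support) : IsAdmissible μ := by
  have key : ∀ s ∈ insert 1 S, s ∈ Subsemigroup.closure μ.support := fun s hs =>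
    Subsemigroup.subset_closure (hμ hs)
  have h : ∀ g : Γ, g ∈ Subsemigroup.closure μ.support ∧ g⁻¹ ∈ Subsemigroup.closure μ.support := by
    intro g
    have hg : g ∈ Subgroup.closure S := hSgen ▸ Subgroup.mem_top g
    induction hg using Subgroup.closure_induction with
    | mem x hx => exact ⟨key x (Or.inr hx), key _ (Or.inr (hSsymm x hx))⟩
    | one =>
      rw [inv_one]
      exact ⟨key 1 (Or.inl rfl), key 1 (Or.inl rfl)⟩
    | mul x y _ _ hx hy =>
      rw [mul_inv_rev]
      exact ⟨mul_mem hx.1 hy.1, mul_mem hy.2 hx.2⟩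
    | inv x _ hx => exact ⟨hx.2, by simpa using hx.1⟩
  exact eq_top_iff.2 fun g _ => (h g).1

/-- The uniform part is controlled by the contraction hypothesis, the remainder by Young's
inequality. -/
theorem tsum_sq_convolve_uniformOn_add_le {Γ : Type*} [Group Γ] {T : Finset Γ}
    (hT : ∀ s ∈ T, s⁻¹ ∈ T) {ρ : ℝ≥0}
    (hρ : ∀ f : Γ → ℝ≥0∞,
      ∑' g, ((T.card : ℝ≥0∞)⁻¹ * ∑ s ∈ T, f (g * s)) ^ 2 ≤ ρ * ∑' g, f g ^ 2)
    {a t b : ℝ≥0} (ht : 0 < t) {τ ν : Γ → ℝ≥0∞} (hτ : ∑' g, τ g ≤ b)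
    (hν : ∀ g, ν g ≤ a * uniformOn T g + τ g) (f : Γ → ℝ≥0∞) :
    ∑' g, convolve f ν g ^ 2 ≤
      ((1 + t) * a ^ 2 * ρ + (1 + t⁻¹) * b ^ 2 : ℝ≥0) * ∑' g, f g ^ 2 := by
  calc ∑' g, convolve f ν g ^ 2
      ≤ ∑' g, ((1 + t : ℝ≥0) * (a * convolve f (uniformOn T) g) ^ 2
          + (1 + t⁻¹ : ℝ≥0) * convolve f τ g ^ 2) := by
        refine ENNReal.tsum_le_tsum fun g => le_trans ?_ (ENNReal.add_sq_le _ _ ht)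
        rw [← convolve_const_mul_right, ← convolve_add_right]
        gcongr
        exact convolve_mono_right f hν g
    _ = (1 + t : ℝ≥0) * (a ^ 2 * ∑' g, convolve f (uniformOn T) g ^ 2)
          + (1 + t⁻¹ : ℝ≥0) * ∑' g, convolve f τ g ^ 2 := by
        simp only [ENNReal.tsum_add, ENNReal.tsum_mul_left, mul_pow]
    _ ≤ (1 + t : ℝ≥0) * (a ^ 2 * (ρ * ∑' g, f g ^ 2))
          + (1 + t⁻¹ : ℝ≥0) * ((b : ℝ≥0∞) ^ 2 * ∑' g, f g ^ 2) := by
        gcongr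
        · simp only [convolve_uniformOn f hT]
          exact hρ f
        · refine (tsum_sq_convolve_le f τ).trans ?_
          gcongr
    _ = _ := by
        push_cast
        ring

/-- Markov's inequality for the weight; the linear factor eventually absorbs the constant, so the
rate is exactly `1 + η`. -/
theorem hasExponentialTails_of_tsum_ne_top {Γ : Type*} [Group Γ] {S : Set Γ} {μ : PMF Γ}
    {η : ℝ≥0} (hη : 0 < η)
    (h : ∑' g, μ g * (polyExpWeight η (wordDist S 1 g) : ℝ≥0∞) ≠ ∞) :
    HasExponentialTails S μ := by
  refine ⟨1 + η, by simpa using hη, ?_⟩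
  obtain ⟨K, hK⟩ : ∃ K : ℝ≥0, (K : ℝ≥0∞) = _ := ⟨_, ENNReal.coe_toNNReal h⟩
  have hev : ∀ᶠ n : ℕ in atTop, K ≤ 1 + η * n := by
    have : Tendsto (fun n : ℕ => η * (n : ℝ≥0)) atTop atTop :=
      tendsto_natCast_atTop_atTop.const_mul_atTop hη
    filter_upwards [this.eventually_ge_atTop K] with n hn
    exact hn.trans le_add_self
  filter_upwards [hev] with n hn
  rw [PMF.toOuterMeasure_apply]
  set A := ∑' g, Set.indicator {g : Γ | n < wordDist S 1 g} μ g
  have hA : A * polyExpWeight η n ≤ K := by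
    rw [hK, ← ENNReal.tsum_mul_right]
    refine ENNReal.tsum_le_tsum fun g => ?_
    by_cases hg : n < wordDist S 1 g
    · rw [Set.indicator_of_mem (by exact hg)]
      gcongr
      exact polyExpWeight_mono η hg.le
    · rw [Set.indicator_of_notMem (by exact hg), zero_mul]
      exact zero_le
  have hAt : A ≠ ∞ := by
    refine ne_top_of_le_ne_top ENNReal.coe_ne_top (le_trans ?_ hA)
    exact le_mul_of_one_le_right' (by exact_mod_cast one_le_polyExpWeight η n)
  clear_value A
  lift A to ℝ≥0 using hAt
  norm_cast at hA
  have hpow : (0 : ℝ≥0) < (1 + η) ^ n := by positivity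
  have hpos : (0 : ℝ≥0) < 1 + η * n := by positivity
  have h1 : A * (1 + η) ^ n ≤ 1 := by
    refine le_of_mul_le_mul_right (a := 1 + η * (n : ℝ≥0)) ?_ hpos
    rw [one_mul, mul_assoc]
    exact hA.trans hn
  have h2 : A ≤ ((1 + η) ^ n)⁻¹ := by
    rwa [← one_div, le_div_iff₀ hpow]
  have h3 : ENNReal.ofReal (((1 + (η : ℝ)) ^ n)⁻¹) = (((1 + η) ^ n)⁻¹ : ℝ≥0) := by
    rw [← ENNReal.ofReal_coe_nnreal]
    push_cast
    rfl
  rw [h3]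
  exact ENNReal.coe_le_coe.2 h2

/-- Here `a`, `p`, `q` stand for `G (1, x j)`, `G (1, y j)`, `G (y j, x j)`. The gain `4 ^ j` of
`polyExpWeight_two_mul` beats the decay `2 ^ (-j)` of the atom. -/
theorem mul_two_pow_le_of_green_bounds {η b C G a p q : ℝ≥0} (j : ℕ)
    (ha : 2⁻¹ * (b * 2⁻¹ ^ (j + 2) * (polyExpWeight η (2 * 4 ^ j))⁻¹) ≤ a)
    (hpq : a ≤ C * p * q) (hp : p * polyExpWeight η (4 ^ j) ≤ G)
    (hq : q * polyExpWeight η (4 ^ j) ≤ G) :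
    b * η * 2 ^ j ≤ 16 * C * G ^ 2 := by
  have hw := polyExpWeight_two_mul η (4 ^ j)
  have hv0 : 0 < polyExpWeight η (2 * 4 ^ j) := one_pos.trans_le (one_le_polyExpWeight _ _)
  have hw0 : 0 < polyExpWeight η (4 ^ j) := one_pos.trans_le (one_le_polyExpWeight _ _)
  set v := polyExpWeight η (2 * 4 ^ j)
  set w := polyExpWeight η (4 ^ j)
  push_cast at hw
  refine le_of_mul_le_mul_right (a := w ^ 2 * v) ?_ (by positivity)
  have h4 : (4 : ℝ≥0) ^ j = 2 ^ j * 2 ^ j := by rw [← mul_pow]; norm_num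
  obtain ⟨X, hX⟩ : ∃ X, X = 2⁻¹ * (b * 2⁻¹ ^ (j + 2) * v⁻¹) := ⟨_, rfl⟩
  rw [← hX] at ha
  calc b * η * 2 ^ j * (w ^ 2 * v)
      = 8 * X * w ^ 2 * v * (v * (η * 4 ^ j)) := by
        rw [hX, h4, inv_pow, pow_add]
        field_simp
        norm_num
    _ ≤ 8 * (C * p * q) * w ^ 2 * v * (v * (1 + η * 4 ^ j)) := by
        gcongr
        · exact ha.trans hpq
        · exact le_add_self
    _ = 8 * C * (p * w) * (q * w) * v * (v * (1 + η * 4 ^ j)) := by ring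
    _ ≤ 8 * C * G * G * v * (2 * w ^ 2) := by gcongr
    _ = _ := by ring

/-! ### Construction of the measure and failure of Ancona inequalities -/

theorem proposition3p2 {Γ : Type*} [Group Γ] (hΓ : ¬ IsAmenableGroup Γ)
    (S : Set Γ) (hSfin : S.Finite) (hSsymm : ∀ s ∈ S, s⁻¹ ∈ S)
    (hSgen : Subgroup.closure S = ⊤) :
    ∃ μ : PMF Γ, IsAdmissible μ ∧ IsSymmetricPMF μ ∧ HasExponentialTails S μ ∧
      (∀ x y : Γ, green μ x y ≠ ∞) ∧
      ¬ ∃ C : ℝ≥0, ∀ x y z : Γ, OrderedOnGeodesic S x y z →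
        green μ x z ≤ C * green μ x y * green μ y z := by
  have := infinite_of_not_isAmenableGroup hΓ hSsymm hSgen
  set T : Finset Γ := (hSfin.insert 1).toFinset
  have hT : ∀ s, s ∈ T ↔ s ∈ insert 1 S := fun s => Set.Finite.mem_toFinset _
  have h1T : (1 : Γ) ∈ T := (hT 1).2 (Or.inl rfl)
  have hTinv : ∀ s ∈ T, s⁻¹ ∈ T := by
    intro s hs
    rcases (hT s).1 hs with rfl | hs
    · simpa using h1T
    · exact (hT _).2 (Or.inr (hSsymm s hs))
  obtain ⟨ρ, hρ1, hρ⟩ := exists_l2_contraction hΓ hSsymm hSgen T h1T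
    fun s hs => (hT s).2 (Or.inr hs)
  obtain ⟨η, b, r, hη, hb, hb1, hr, hr2⟩ := exists_contraction_parameters hρ1
  -- `y j` is the midpoint and `x j` the far endpoint.
  choose y x hgeo hy hyx hx using
    fun j : ℕ => exists_orderedOnGeodesic hSfin hSsymm hSgen (4 ^ j)
  let W : Γ → ℝ≥0∞ := fun g => polyExpWeight η (wordDist S 1 g)
  have hW1 : W 1 = 1 := by simp [W, wordDist_self, polyExpWeight_zero]
  have one_le_W : ∀ g, 1 ≤ W g := fun g =>
    ENNReal.coe_le_coe.2 (one_le_polyExpWeight η _)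
  have hWmul : ∀ g h, W (g * h) ≤ W g * W h := fun g h => by
    have := (polyExpWeight_mono η (wordDist_one_mul_le hSgen g h)).trans
      (polyExpWeight_add_le η _ _)
    simp only [W]
    exact_mod_cast this
  -- The atoms at `x j` and its inverse have joint weighted mass `b * 2⁻¹ ^ (j + 1)`, hence total
  -- `b`.
  let c : ℕ → ℝ≥0∞ := fun j =>
    (b * 2⁻¹ ^ (j + 2) * (polyExpWeight η (2 * 4 ^ j))⁻¹ : ℝ≥0)
  let τ := jumpMeasure x c
  have hτW : ∑' g, τ g * W g = b := by
    rw [tsum_jumpMeasure_mul]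
    have h1 : ∀ j, c j * (W (x j) + W (x j)⁻¹) = b * 2⁻¹ ^ (j + 1) := by
      intro j
      have hv : polyExpWeight η (2 * 4 ^ j) ≠ 0 :=
        (one_pos.trans_le (one_le_polyExpWeight _ _)).ne'
      have h2 : (2⁻¹ : ℝ≥0∞) = (2⁻¹ : ℝ≥0) := by simp
      simp only [W, wordDist_one_inv hSgen, hx, c]
      rw [h2]
      norm_cast
      rw [inv_pow, inv_pow, pow_add, pow_add]
      field_simp
      norm_num
    simp only [h1]
    rw [ENNReal.tsum_mul_left, ENNReal.tsum_geometric_add_one, ENNReal.one_sub_inv_two, inv_inv,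
      ENNReal.inv_mul_cancel (by simp) (by simp), mul_one]
  have hτ : ∑' g, τ g ≤ 1 := by
    calc ∑' g, τ g ≤ ∑' g, τ g * W g :=
          ENNReal.tsum_le_tsum fun g => le_mul_of_one_le_right' (one_le_W g)
      _ ≤ 1 := by rw [hτW]; exact_mod_cast hb1
  -- The total mass lies in `[1, 2]`, so normalizing preserves upper bounds and at most halves lower
  -- ones.
  let κ : Γ → ℝ≥0∞ := fun g => uniformOn T g + τ g
  have hκsum : ∑' g, κ g = 1 + ∑' g, τ g := by
    rw [ENNReal.tsum_add, tsum_uniformOn ⟨1, h1T⟩]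
  have hκ1 : 1 ≤ ∑' g, κ g := hκsum ▸ le_self_add
  have hκ2 : ∑' g, κ g ≤ 2 := by
    rw [hκsum, ← one_add_one_eq_two]
    gcongr
  have hκ0 : ∑' g, κ g ≠ 0 := (one_pos.trans_le hκ1).ne'
  have hκt : ∑' g, κ g ≠ ∞ := ne_top_of_le_ne_top (by simp) hκ2
  let μ : PMF Γ := PMF.normalize κ hκ0 hκt
  have hμκ : ∀ g, μ g ≤ κ g := fun g =>
    mul_le_of_le_one_right' (ENNReal.inv_le_one.2 hκ1)
  have hκμ : ∀ g, 2⁻¹ * κ g ≤ μ g := fun g => by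
    rw [mul_comm]
    exact mul_le_mul_right (ENNReal.inv_le_inv.2 hκ2) _
  have hμW : ∀ g, μ g * W g ≤ ((1 + η) ^ 2 : ℝ≥0) * uniformOn T g + τ g * W g := by
    intro g
    refine (mul_le_mul_left (hμκ g) _).trans ?_
    simp only [κ, add_mul]
    refine add_le_add ?_ le_rfl
    by_cases hg : g ∈ T
    · rw [mul_comm]
      refine mul_le_mul_left ?_ _
      rw [← polyExpWeight_one]
      exact ENNReal.coe_le_coe.2 <| polyExpWeight_mono η (wordDist_one_le_one ((hT g).1 hg))
    · rw [uniformOn, Set.indicator_of_notMem (by simpa using hg), zero_mul]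
      exact zero_le
  have hcontr : ∀ f : Γ → ℝ≥0∞,
      ∑' g, convolve f (fun x => μ x * W x) g ^ 2 ≤ (r : ℝ≥0∞) ^ 2 * ∑' g, f g ^ 2 := by
    intro f
    refine (tsum_sq_convolve_uniformOn_add_le hTinv hρ hη hτW.le hμW f).trans ?_
    gcongr
    rw [← ENNReal.coe_pow]
    refine ENNReal.coe_le_coe.2 (le_trans (le_of_eq ?_) hr2)
    ring
  have hgreen : ∀ x y, green μ x y * W (x⁻¹ * y) ≤ (((1 - r)⁻¹ : ℝ≥0) : ℝ≥0∞) := by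
    intro x y
    rw [ENNReal.coe_inv (tsub_pos_of_lt hr).ne']
    push_cast
    exact green_mul_le hW1.le hWmul hcontr x y
  have hfin : ∀ x y, green μ x y ≠ ∞ := fun x y =>
    ne_top_of_le_ne_top ENNReal.coe_ne_top
      ((le_mul_of_one_le_right' (one_le_W _)).trans (hgreen x y))
  refine ⟨μ, isAdmissible_of_subset_support hSsymm hSgen ?_, ?_,
    hasExponentialTails_of_tsum_ne_top hη ?_, hfin, ?_⟩
  · intro s hs
    rw [PMF.support_normalize, Function.mem_support]
    have h1 : uniformOn T s ≠ 0 := by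
      rw [uniformOn, Set.indicator_of_mem (by simpa using (hT s).2 hs)]
      simp
    exact fun h => h1 (add_eq_zero.1 h).1
  · intro g
    have : κ g⁻¹ = κ g := by
      simp only [κ, τ, uniformOn_inv hTinv, jumpMeasure_inv]
    simp only [μ, PMF.normalize_apply, this]
  · refine ne_top_of_le_ne_top ?_ (ENNReal.tsum_le_tsum hμW)
    rw [ENNReal.tsum_add, ENNReal.tsum_mul_left, tsum_uniformOn ⟨1, h1T⟩, hτW]
    exact ENNReal.add_ne_top.2 ⟨by simp, ENNReal.coe_ne_top⟩
  · rintro ⟨C, hC⟩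
    have hbound : ∀ j : ℕ, b * η * 2 ^ j ≤ 16 * C * ((1 - r)⁻¹) ^ 2 := by
      intro j
      have h1 := hC _ _ _ (hgeo j)
      have h2 := hgreen 1 (y j)
      have h3 := hgreen (y j) (x j)
      have h4 : 2⁻¹ * c j ≤ green μ 1 (x j) := by
        refine le_trans ?_ (le_green μ 1 (x j))
        rw [inv_one, one_mul]
        refine le_trans ?_ (hκμ _)
        gcongr
        exact (le_jumpMeasure x c j).trans le_add_self
      simp only [W, wordDist_one_inv_mul hSgen, hy, hyx] at h2 h3
      obtain ⟨a, ha⟩ : ∃ a : ℝ≥0, (a : ℝ≥0∞) = _ := ⟨_, ENNReal.coe_toNNReal (hfin 1 (x j))⟩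
      obtain ⟨p, hp⟩ : ∃ p : ℝ≥0, (p : ℝ≥0∞) = _ := ⟨_, ENNReal.coe_toNNReal (hfin 1 (y j))⟩
      obtain ⟨q, hq⟩ : ∃ q : ℝ≥0, (q : ℝ≥0∞) = _ := ⟨_, ENNReal.coe_toNNReal (hfin (y j) (x j))⟩
      rw [← ha, ← hp, ← hq] at h1
      rw [← hp] at h2
      rw [← hq] at h3
      have h5 : (2⁻¹ : ℝ≥0∞) = (2⁻¹ : ℝ≥0) := by simp
      rw [← ha, h5, ← ENNReal.coe_mul, ENNReal.coe_le_coe] at h4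
      exact mul_two_pow_le_of_green_bounds j h4 (by exact_mod_cast h1)
        (by exact_mod_cast h2) (by exact_mod_cast h3)
    have htend : Tendsto (fun j : ℕ => b * η * (2 : ℝ≥0) ^ j) atTop atTop :=
      (tendsto_pow_atTop_atTop_of_one_lt one_lt_two).const_mul_atTop (mul_pos hb hη)
    obtain ⟨j, hj⟩ := (htend.eventually_gt_atTop (16 * C * ((1 - r)⁻¹) ^ 2)).exists
    exact absurd (hbound j) hj.not_ge
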